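/- Let $\sigma^{(0)}=I_2$ and let $\sigma^{(1)},\sigma^{(2)},\sigma^{(3)}$ be the Pauli matrices. On $(\mathbb{C}^2)^{\otimes n}$ let $\sigma_j^{(a)}=I_2^{\otimes(j-1)}\otimes\sigma^{(a)}\otimes I_2^{\otimes(n-j)}$ for $1\le j\le n$, and $\sigma_{n+1}^{(a)}=\sigma_1^{(a)}$. For $n=2,3,\dots$ let $$H_n=\frac{1}{\sqrt n}\sum_{j=1}^n\sum_{a=0}^3\sum_{b=1}^3\alpha_{a,b,j}\,\sigma_j^{(a)}\sigma_{j+1}^{(b)},$$ where the $\alpha_{a,b,j}=\alpha_{a,b,j}(n)$ are real numbers such that, for each $n\ge 2$, $$\frac1n\sum_{j=1}^n\sum_{a=0}^3\sum_{b=1}^3\alpha_{a,b,j}^2=1\qquad\text{and}\qquad|\alpha_{a,b,j}|<C\ \text{ for all } a,b,j,$$ with a constant $C>0$ independent of $a,b,j$ and $n$. (No translation invariance is assumed.) For $n\ge 3$ the left-hand side of the normalisation condition equals $\frac{1}{2^n}\operatorname{Tr}(H_n^2)$. Let $\lambda_1,\dots,\lambda_{2^n}$ be the eigenvalues of $H_n$,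 counted with multiplicity, and let $\rho_n=\frac{1}{2^n}\sum_{k=1}^{2^n}\delta_{\lambda_k}$ be its density of states measure. Then, as $n\to\infty$, $\rho_n$ converges weakly to the standard normal distribution; that is, $$\lim_{n\to\infty}\rho_n\big((-\infty,x]\big)=\frac{1}{\sqrt{2\pi}}\int_{-\infty}^x e^{-\lambda^2/2}\,d\lambda\qquad\text{for all }x\in\mathbb{R}.$$ -/

import Mathlib

open MeasureTheory ProbabilityTheory Filter Topology

namespace SpinChain

/-- The identity and the three Pauli matrices `σ⁽⁰⁾, σ⁽¹⁾, σ⁽²⁾, σ⁽³⁾`. -/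
def pauli : Fin 4 → Matrix (Fin 2) (Fin 2) ℂ :=
  ![!![1, 0; 0, 1], !![0, 1; 1, 0], !![0, -Complex.I; Complex.I, 0], !![1, 0; 0, -1]]

/-- The Kronecker product `M 0 ⊗ M 1 ⊗ ⋯ ⊗ M (n - 1)` of `2 × 2` matrices, written in the product
basis of `(ℂ²)^{⊗ n}`, which is indexed by the configurations `Fin n → Fin 2`. -/
def tensor {n : ℕ} (M : Fin n → Matrix (Fin 2) (Fin 2) ℂ) :
    Matrix (Fin n → Fin 2) (Fin n → Fin 2) ℂ :=
  Matrix.of fun x y => ∏ i, M i (x i) (y i)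

/-- `σ_j⁽ᵃ⁾ = I ⊗ ⋯ ⊗ I ⊗ σ⁽ᵃ⁾ ⊗ I ⊗ ⋯ ⊗ I`, with `σ⁽ᵃ⁾` at site `j`. -/
def siteOp {n : ℕ} (j : Fin n) (a : Fin 4) : Matrix (Fin n → Fin 2) (Fin n → Fin 2) ℂ :=
  tensor (Function.update (fun _ => 1) j (pauli a))

/-- The Hamiltonian
`H_n = n^{-1/2} ∑_j ∑_{a=0}^3 ∑_{b=1}^3 α_{a,b,j} σ_j⁽ᵃ⁾ σ_{j+1}⁽ᵇ⁾` of a ring of `n` qubits.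
The index `b : Fin 3` stands for `b + 1 ∈ {1, 2, 3}`; `finRotate n j` is the cyclic successor of
the site `j`. -/
noncomputable def hamiltonian (n : ℕ) (α : Fin 4 → Fin 3 → Fin n → ℝ) :
    Matrix (Fin n → Fin 2) (Fin n → Fin 2) ℂ :=
  ((1 / √(n : ℝ) : ℝ) : ℂ) •
    ∑ j : Fin n, ∑ a : Fin 4, ∑ b : Fin 3,
      ((α a b j : ℝ) : ℂ) • (siteOp j a * siteOp (finRotate n j) b.succ)

theorem pauli_conjTranspose (a : Fin 4) : (pauli a).conjTranspose = pauli a := by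
  fin_cases a <;> ext i j <;> fin_cases i <;> fin_cases j <;> simp [pauli]

theorem tensor_mul {n : ℕ} (M N : Fin n → Matrix (Fin 2) (Fin 2) ℂ) :
    tensor M * tensor N = tensor (fun i => M i * N i) := by
  ext x y
  simp only [tensor, Matrix.mul_apply, Matrix.of_apply, ← Finset.prod_mul_distrib]
  rw [Finset.prod_univ_sum, Fintype.piFinset_univ]

theorem tensor_conjTranspose {n : ℕ} (M : Fin n → Matrix (Fin 2) (Fin 2) ℂ) :
    (tensor M).conjTranspose = tensor (fun i => (M i).conjTranspose) := by
  ext x y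
  simp [tensor, Matrix.conjTranspose_apply]

theorem siteOp_isHermitian {n : ℕ} (j : Fin n) (a : Fin 4) : (siteOp j a).IsHermitian := by
  unfold Matrix.IsHermitian siteOp
  rw [tensor_conjTranspose]
  congr 1
  funext i
  by_cases h : i = j
  · subst h; simp [pauli_conjTranspose]
  · simp [Function.update_of_ne h]

theorem siteOp_commute {n : ℕ} {i j : Fin n} (hij : i ≠ j) (a b : Fin 4) :
    Commute (siteOp i a) (siteOp j b) := by
  unfold Commute SemiconjBy siteOp
  rw [tensor_mul, tensor_mul]
  congr 1
  funext k
  by_cases h : k = i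
  · subst h; simp [Function.update_of_ne hij]
  · simp [Function.update_of_ne h]

theorem finRotate_ne {n : ℕ} (hn : 2 ≤ n) (j : Fin n) : j ≠ finRotate n j := by
  obtain ⟨m, rfl⟩ : ∃ m, n = m + 2 := ⟨n - 2, by omega⟩
  rw [finRotate_apply]
  intro h
  simp at h

theorem hamiltonian_isHermitian {n : ℕ} (hn : 2 ≤ n) (α : Fin 4 → Fin 3 → Fin n → ℝ) :
    (hamiltonian n α).IsHermitian := by
  have key : ∀ (j : Fin n) (a b : Fin 4),
      (siteOp j a * siteOp (finRotate n j) b).conjTranspose =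
        siteOp j a * siteOp (finRotate n j) b := fun j a b =>
    ((siteOp_isHermitian j a).commute_iff (siteOp_isHermitian _ b)).1
      (siteOp_commute (finRotate_ne hn j) a b)
  simp [Matrix.IsHermitian, hamiltonian, Matrix.conjTranspose_smul, Matrix.conjTranspose_sum,
    -Matrix.conjTranspose_mul, -finRotate_apply, key]

/-- The density of states measure `2^{-n} ∑_k δ_{λ_k}` of a Hermitian operator on `n` qubits, with
eigenvalues `λ_k` listed with multiplicity. -/
noncomputable def eigenvalueMeasure {n : ℕ} {A : Matrix (Fin n → Fin 2) (Fin n → Fin 2) ℂ}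
    (hA : A.IsHermitian) : Measure ℝ :=
  ((2 : ENNReal) ^ n)⁻¹ • ∑ k : Fin n → Fin 2, Measure.dirac (hA.eigenvalues k)

theorem isProbabilityMeasure_eigenvalueMeasure {n : ℕ}
    {A : Matrix (Fin n → Fin 2) (Fin n → Fin 2) ℂ} (hA : A.IsHermitian) :
    IsProbabilityMeasure (eigenvalueMeasure hA) := by
  constructor
  simp [eigenvalueMeasure]
  exact ENNReal.inv_mul_cancel (by simp) (by simp)

/-- The density of states of the ring Hamiltonian `H_n`, `n ≥ 2`, as a probability measure. -/
noncomputable def densityOfStates (n : ℕ) (hn : 2 ≤ n) (α : Fin 4 → Fin 3 → Fin n → ℝ) :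
    ProbabilityMeasure ℝ :=
  ⟨eigenvalueMeasure (hamiltonian_isHermitian hn α), isProbabilityMeasure_eigenvalueMeasure _⟩

/-- The standard normal distribution as a probability measure. -/
noncomputable def stdNormal : ProbabilityMeasure ℝ := ⟨gaussianReal 0 1, inferInstance⟩

end SpinChain

/-!
The proof is Lindeberg's argument for the characteristic function of the density of states, which is
the normalized trace of `exp (i t H_n)` (`SpinChain.charFun_eigenvalueMeasure`); by Lévy's theorem
it suffices that it tends to `exp (-t² / 2)`.

Products of Pauli matrices are orthonormal for the normalized trace, so every link of the ring has
mean zero, different links are uncorrelated, and the variance of a set of links is the sum of the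
squares of its coefficients divided by `n` (`SpinChain.normTrace_partialHamiltonian_sq`).

Cut the ring into intervals of `L` sites and drop the links between different intervals. By
Duhamel's formula and the Cauchy–Schwarz inequality this changes the characteristic function by at
most `|t|` times the square root of the variance of the dropped links
(`SpinChain.norm_normTrace_exp_sub_le`), which is of order `1 / L + 1 / n` because the coefficients
are bounded. The remaining blocks act on disjoint sets of sites. They commute and are independent for
the normalized trace, so the characteristic function factorizes (`SpinChain.normTrace_exp_sum`). Each
block has operator norm of order `L / √n`, hence its factor is Gaussian up to an error of order
`|t|³ L / √n` times its variance (`SpinChain.norm_normTrace_exp_sub_gaussian_le`). As the variances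
add up to at most `1`, the total error vanishes for `L` of order `n ^ (1 / 4)`
(`SpinChain.tendsto_normTrace_exp_hamiltonian`). The convergence of the distribution functions
follows from weak convergence, as the normal distribution has no atoms.
-/

namespace SpinChain

-- Matrices carry the operator norm of `ℂ^N → ℂ^N` with the Euclidean norm.
open scoped Matrix.Norms.L2Operator

/-! ### The normalized trace and characteristic functions of Hermitian matrices -/

section NormalizedTrace

variable {ι : Type*} [Fintype ι]

/-- The normalized trace `Tr A / dim`. -/
noncomputable def normTrace : Matrix ι ι ℂ →ₗ[ℂ] ℂ :=
  (Fintype.card ι : ℂ)⁻¹ • Matrix.traceLinearMap ι ℂ ℂ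

theorem normTrace_apply (A : Matrix ι ι ℂ) :
    normTrace A = (Fintype.card ι : ℂ)⁻¹ * A.trace := rfl

theorem normTrace_mul_comm (A B : Matrix ι ι ℂ) : normTrace (A * B) = normTrace (B * A) := by
  rw [normTrace_apply, normTrace_apply, Matrix.trace_mul_comm]

/-- The Cauchy–Schwarz inequality for the Hilbert–Schmidt inner product given by the normalized
trace. -/
theorem norm_normTrace_mul_le (A B : Matrix ι ι ℂ) :
    ‖normTrace (A * B)‖ ≤ √(normTrace (A * A.conjTranspose)).re *
      √(normTrace (B.conjTranspose * B)).re := by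
  have hA : (normTrace (A * A.conjTranspose)).re
      = (Fintype.card ι : ℝ)⁻¹ * ∑ p : ι × ι, ‖A p.1 p.2‖ ^ 2 := by
    rw [normTrace_apply, Matrix.trace, ← Complex.ofReal_natCast, ← Complex.ofReal_inv,
      Complex.re_ofReal_mul, Complex.re_sum, Fintype.sum_prod_type]
    congr 1
    refine Finset.sum_congr rfl fun i _ => ?_
    simp [Matrix.mul_apply, Complex.mul_conj, Complex.normSq_eq_norm_sq, -Complex.ofReal_pow]
  have hB : (normTrace (B.conjTranspose * B)).re
      = (Fintype.card ι : ℝ)⁻¹ * ∑ p : ι × ι, ‖B p.2 p.1‖ ^ 2 := by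
    rw [normTrace_apply, Matrix.trace, ← Complex.ofReal_natCast, ← Complex.ofReal_inv,
      Complex.re_ofReal_mul, Complex.re_sum, Fintype.sum_prod_type]
    congr 1
    refine Finset.sum_congr rfl fun i _ => ?_
    simp [Matrix.mul_apply, Complex.conj_mul', -Complex.ofReal_pow, ← Complex.ofReal_pow]
  have h0 : (0 : ℝ) ≤ (Fintype.card ι : ℝ)⁻¹ := by positivity
  rw [hA, hB, Real.sqrt_mul h0, Real.sqrt_mul h0,
    mul_mul_mul_comm, Real.mul_self_sqrt h0, normTrace_apply, norm_mul, norm_inv,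
    Complex.norm_natCast]
  refine mul_le_mul_of_nonneg_left ?_ h0
  have htr : (A * B).trace = ∑ p : ι × ι, A p.1 p.2 * B p.2 p.1 := by
    simp [Matrix.trace, Matrix.mul_apply, Fintype.sum_prod_type]
  rw [htr]
  refine (norm_sum_le _ _).trans ?_
  simp_rw [norm_mul]
  exact Real.sum_mul_le_sqrt_mul_sqrt _ _ _

variable [DecidableEq ι]

theorem normTrace_one [Nonempty ι] : normTrace (1 : Matrix ι ι ℂ) = 1 := by
  simp [normTrace_apply]

theorem normTrace_conjTranspose_mul_self_of_unitary [Nonempty ι] {U : Matrix ι ι ℂ}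
    (hU : U ∈ unitary (Matrix ι ι ℂ)) : normTrace (U.conjTranspose * U) = 1 := by
  have : U.conjTranspose * U = 1 := (Unitary.mem_iff.1 hU).1
  rw [this, normTrace_one]

theorem exp_I_smul_mem_unitary {A : Matrix ι ι ℂ} (hA : A.IsHermitian) (t : ℝ) :
    NormedSpace.exp (((t : ℂ) * Complex.I) • A) ∈ unitary (Matrix ι ι ℂ) := by
  let _ : NormedAlgebra ℚ (Matrix ι ι ℂ) := NormedAlgebra.restrictScalars ℚ ℂ _
  apply NormedSpace.exp_mem_unitary_of_mem_skewAdjoint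
  rw [skewAdjoint.mem_iff]
  have : star A = A := hA
  simp [star_smul, this]

theorem norm_normTrace_exp_le_one [Nonempty ι] {A : Matrix ι ι ℂ} (hA : A.IsHermitian) (t : ℝ) :
    ‖normTrace (NormedSpace.exp (((t : ℂ) * Complex.I) • A))‖ ≤ 1 := by
  have h := norm_normTrace_mul_le 1 (NormedSpace.exp (((t : ℂ) * Complex.I) • A))
  rw [normTrace_conjTranspose_mul_self_of_unitary (exp_I_smul_mem_unitary hA t)] at h
  simpa [normTrace_one] using h

/-- The characteristic function is Lipschitz in the Hamiltonian for the normalized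
Hilbert–Schmidt norm, with a constant that does not depend on the dimension. This follows from
Duhamel's formula, that is, from differentiating `s ↦ exp (s X) exp ((1 - s) Y)`. -/
theorem norm_normTrace_exp_sub_le [Nonempty ι] {A B : Matrix ι ι ℂ} (hA : A.IsHermitian)
    (hB : B.IsHermitian) (t : ℝ) :
    ‖normTrace (NormedSpace.exp (((t : ℂ) * Complex.I) • A)) -
      normTrace (NormedSpace.exp (((t : ℂ) * Complex.I) • B))‖ ≤
      |t| * √(normTrace ((A - B) ^ 2)).re := by
  set X := ((t : ℂ) * Complex.I) • A with hX
  set Y := ((t : ℂ) * Complex.I) • B with hY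
  let T : Matrix ι ι ℂ →L[ℝ] ℂ :=
    ((normTrace (ι := ι)).restrictScalars ℝ).toContinuousLinearMap
  have hT : ∀ Z, T Z = normTrace Z := fun _ => rfl
  have hderiv : ∀ s : ℝ, HasDerivAt
      (fun s : ℝ => T (NormedSpace.exp (s • X) * NormedSpace.exp ((1 - s) • Y)))
      (T (NormedSpace.exp (s • X) * (X - Y) * NormedSpace.exp ((1 - s) • Y))) s := by
    intro s
    have h1 : HasDerivAt (fun s : ℝ => NormedSpace.exp (s • X))
        (NormedSpace.exp (s • X) * X) s := hasDerivAt_exp_smul_const X s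
    have h2 : HasDerivAt (fun s : ℝ => NormedSpace.exp ((1 - s) • Y))
        ((-1 : ℝ) • (Y * NormedSpace.exp ((1 - s) • Y))) s :=
      HasDerivAt.scomp s (hasDerivAt_exp_smul_const' Y (1 - s)) ((hasDerivAt_id s).const_sub 1)
    have h3 := T.hasFDerivAt.comp_hasDerivAt s (h1.mul h2)
    convert! h3 using 2
    simp only [neg_smul, one_smul]
    noncomm_ring
  have hbound : ∀ s : ℝ,
      ‖T (NormedSpace.exp (s • X) * (X - Y) * NormedSpace.exp ((1 - s) • Y))‖ ≤
        |t| * √(normTrace ((A - B) ^ 2)).re := by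
    intro s
    have hXs : s • X = (((s * t : ℝ) : ℂ) * Complex.I) • A := by
      rw [hX, ← Complex.coe_smul, smul_smul]; push_cast; ring_nf
    have hYs : (1 - s) • Y = ((((1 - s) * t : ℝ) : ℂ) * Complex.I) • B := by
      rw [hY, ← Complex.coe_smul, smul_smul]; push_cast; ring_nf
    have hXY : X - Y = ((t : ℂ) * Complex.I) • (A - B) := by rw [hX, hY, smul_sub]
    rw [hT, hXs, hYs, hXY, mul_assoc, normTrace_mul_comm, mul_assoc, smul_mul_assoc, map_smul,
      norm_smul]
    have hU := mul_mem (exp_I_smul_mem_unitary hB ((1 - s) * t))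
      (exp_I_smul_mem_unitary hA (s * t))
    refine mul_le_mul (by simp) ?_ (norm_nonneg _) (abs_nonneg _)
    have h := norm_normTrace_mul_le (A - B)
      (NormedSpace.exp ((((1 - s) * t : ℝ) * Complex.I : ℂ) • B) *
        NormedSpace.exp (((s * t : ℝ) * Complex.I : ℂ) • A))
    rw [normTrace_conjTranspose_mul_self_of_unitary hU, (hA.sub hB).eq] at h
    simpa [sq] using h
  have := norm_image_sub_le_of_norm_deriv_le_segment_01'
    (fun s _ => (hderiv s).hasDerivWithinAt) (fun s _ => hbound s)
  simpa [hT] using this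

theorem normTrace_unitary_conj {U : Matrix ι ι ℂ} (hU : U ∈ unitary (Matrix ι ι ℂ))
    (D : Matrix ι ι ℂ) : normTrace (U * D * star U) = normTrace D := by
  rw [normTrace_mul_comm, ← mul_assoc, (Unitary.mem_iff.1 hU).1, one_mul]

theorem eq_unitary_conj_diagonal {A : Matrix ι ι ℂ} (hA : A.IsHermitian) :
    A = (hA.eigenvectorUnitary : Matrix ι ι ℂ) *
      Matrix.diagonal (fun k => (hA.eigenvalues k : ℂ)) *
      star (hA.eigenvectorUnitary : Matrix ι ι ℂ) := by
  conv_lhs => rw [hA.spectral_theorem]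
  rw [Unitary.conjStarAlgAut_apply]
  rfl

theorem normTrace_exp_eq {A : Matrix ι ι ℂ} (hA : A.IsHermitian) (t : ℝ) :
    normTrace (NormedSpace.exp (((t : ℂ) * Complex.I) • A)) =
      (Fintype.card ι : ℂ)⁻¹ * ∑ k, Complex.exp (t * Complex.I * hA.eigenvalues k) := by
  have hU := hA.eigenvectorUnitary.2
  set U := (hA.eigenvectorUnitary : Matrix ι ι ℂ)
  have hinv : star U = U⁻¹ := (Matrix.inv_eq_left_inv (Unitary.mem_iff.1 hU).1).symm
  have hunit : IsUnit U := IsUnit.of_mul_eq_one _ (Unitary.mem_iff.1 hU).2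
  have h : ((t : ℂ) * Complex.I) • A = U * Matrix.diagonal
      (fun k => (t : ℂ) * Complex.I * hA.eigenvalues k) * U⁻¹ := by
    conv_lhs => rw [eq_unitary_conj_diagonal hA]
    rw [← hinv, ← Matrix.smul_mul, ← Matrix.mul_smul, ← Matrix.diagonal_smul]
    rfl
  rw [h, Matrix.exp_conj _ _ hunit, Matrix.exp_diagonal, ← hinv, normTrace_unitary_conj hU,
    normTrace_apply, Matrix.trace_diagonal]
  simp [Pi.coe_exp, Complex.exp_eq_exp_ℂ]

theorem normTrace_sq_eq {A : Matrix ι ι ℂ} (hA : A.IsHermitian) :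
    normTrace (A ^ 2) = ((Fintype.card ι : ℝ)⁻¹ * ∑ k, hA.eigenvalues k ^ 2 : ℝ) := by
  have hU := hA.eigenvectorUnitary.2
  set U := (hA.eigenvectorUnitary : Matrix ι ι ℂ)
  have h : A ^ 2 = U * Matrix.diagonal (fun k => (hA.eigenvalues k : ℂ) ^ 2) * star U := by
    conv_lhs => rw [eq_unitary_conj_diagonal hA]
    change (U * _ * star U) ^ 2 = _
    have h1 : star U * U = 1 := (Unitary.mem_iff.1 hU).1
    have : ∀ D : Matrix ι ι ℂ, (U * D * star U) ^ 2 = U * (D * D) * star U := by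
      intro D
      calc (U * D * star U) ^ 2 = U * D * (star U * U) * D * star U := by noncomm_ring
        _ = _ := by rw [h1]; noncomm_ring
    rw [this, Matrix.diagonal_mul_diagonal]
    simp only [sq]
  rw [h, normTrace_unitary_conj hU, normTrace_apply, Matrix.trace_diagonal]
  push_cast
  rfl

theorem normTrace_eq {A : Matrix ι ι ℂ} (hA : A.IsHermitian) :
    normTrace A = (Fintype.card ι : ℂ)⁻¹ * ∑ k, (hA.eigenvalues k : ℂ) := by
  rw [normTrace_apply, hA.trace_eq_sum_eigenvalues]
  rfl

theorem abs_eigenvalues_le_norm {A : Matrix ι ι ℂ} (hA : A.IsHermitian) (k : ι) :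
    |hA.eigenvalues k| ≤ ‖A‖ := by
  have : Nonempty ι := ⟨k⟩
  have h := hA.eigenvalues_mem_spectrum_real k
  simpa using spectrum.norm_le_norm_of_mem h

/-- Comparison of the characteristic function of a centred Hermitian matrix of small norm with that
of the Gaussian of the same variance. The error is proportional to the variance, so that the errors
of many blocks add up to a small total. -/
theorem norm_normTrace_exp_sub_gaussian_le [Nonempty ι] {A : Matrix ι ι ℂ} (hA : A.IsHermitian)
    (h0 : normTrace A = 0) {M t : ℝ} (hM : ‖A‖ ≤ M) (ht : |t| * M ≤ 1) :
    ‖normTrace (NormedSpace.exp (((t : ℂ) * Complex.I) • A)) -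
      Complex.exp (-(t ^ 2 * (normTrace (A ^ 2)).re / 2 : ℝ))‖ ≤
      2 * |t| ^ 3 * M * (normTrace (A ^ 2)).re := by
  have hM0 : 0 ≤ M := (norm_nonneg _).trans hM
  have hN : (0 : ℝ) < (Fintype.card ι : ℝ)⁻¹ := by positivity
  set N := Fintype.card ι with hNdef
  have hN1 : (N : ℂ)⁻¹ * N = 1 := inv_mul_cancel₀ (by simp [N])
  have hN1' : (N : ℝ)⁻¹ * N = 1 := inv_mul_cancel₀ (by simp [N])
  set ev := hA.eigenvalues with hev
  have hl : ∀ k, |ev k| ≤ M := fun k => (abs_eigenvalues_le_norm hA k).trans hM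
  set v := (normTrace (A ^ 2)).re with hv
  have hv' : v = (N : ℝ)⁻¹ * ∑ k, ev k ^ 2 := by rw [hv, normTrace_sq_eq hA, Complex.ofReal_re]
  have hv0 : 0 ≤ v := by rw [hv']; positivity
  have hvM : v ≤ M ^ 2 := by
    rw [hv']
    calc (N : ℝ)⁻¹ * ∑ k, ev k ^ 2 ≤ (N : ℝ)⁻¹ * ∑ _k : ι, M ^ 2 := by
          refine mul_le_mul_of_nonneg_left (Finset.sum_le_sum fun k _ => ?_) hN.le
          exact sq_le_sq' (neg_le_of_abs_le (hl k)) (le_of_abs_le (hl k))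
      _ = M ^ 2 := by
          simp only [Finset.sum_const, Finset.card_univ, nsmul_eq_mul]
          rw [← hNdef, ← mul_assoc, hN1', one_mul]
  have h1 : (N : ℂ)⁻¹ * ∑ k, (ev k : ℂ) = 0 := by rw [← normTrace_eq hA, h0]
  -- Second order expansion of the characteristic function.
  have e1 : ‖normTrace (NormedSpace.exp (((t : ℂ) * Complex.I) • A)) -
      (1 - (t ^ 2 * v / 2 : ℝ))‖ ≤ |t| ^ 3 * M * v := by
    have hexp : (1 - (t ^ 2 * v / 2 : ℝ) : ℂ) = (N : ℂ)⁻¹ * ∑ k, (1 + t * Complex.I * ev k +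
        (t * Complex.I * ev k) ^ 2 / 2) := by
      simp only [mul_pow, Complex.I_sq, Finset.sum_add_distrib, ← Finset.mul_sum,
        ← Finset.sum_div, Finset.sum_const, Finset.card_univ, nsmul_eq_mul, mul_add]
      rw [← hNdef, mul_one, hN1, hv']
      push_cast
      linear_combination (-(t : ℂ) * Complex.I) * h1
    rw [hexp, normTrace_exp_eq hA, ← mul_sub, ← Finset.sum_sub_distrib, norm_mul, norm_inv,
      Complex.norm_natCast, hv', mul_left_comm]
    refine mul_le_mul_of_nonneg_left ?_ hN.le
    rw [Finset.mul_sum]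
    refine (norm_sum_le _ _).trans (Finset.sum_le_sum fun k _ => ?_)
    have hx : ‖(t * Complex.I * ev k : ℂ)‖ = |t| * |ev k| := by simp
    have hx1 : ‖(t * Complex.I * ev k : ℂ)‖ ≤ 1 := by
      rw [hx]; exact (mul_le_mul_of_nonneg_left (hl k) (abs_nonneg _)).trans ht
    have hb := Complex.exp_bound hx1 (n := 3) (by norm_num)
    rw [hx] at hb
    simp only [Finset.sum_range_succ, Finset.sum_range_zero] at hb
    norm_num [Nat.factorial] at hb
    refine hb.trans ?_
    have : |ev k| ^ 3 ≤ M * ev k ^ 2 := by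
      rw [pow_succ', sq_abs]; exact mul_le_mul_of_nonneg_right (hl k) (sq_nonneg _)
    calc (|t| * |ev k|) ^ 3 * (2 / 9) ≤ (|t| * |ev k|) ^ 3 * 1 := by gcongr; norm_num
      _ = |t| ^ 3 * |ev k| ^ 3 := by ring
      _ ≤ |t| ^ 3 * (M * ev k ^ 2) := by gcongr
      _ = _ := by ring
  -- First order expansion of the Gaussian; `v ≤ M ^ 2` makes its error cubic in `M` as well.
  have htM0 : 0 ≤ |t| * M := by positivity
  have htv : t ^ 2 * v ≤ |t| * M := by
    calc t ^ 2 * v ≤ t ^ 2 * M ^ 2 := by gcongr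
      _ = (|t| * M) * (|t| * M) := by rw [← sq_abs t]; ring
      _ ≤ (|t| * M) * 1 := by gcongr
      _ = _ := mul_one _
  have e2 : ‖(1 - (t ^ 2 * v / 2 : ℝ) : ℂ) - Complex.exp (-(t ^ 2 * v / 2 : ℝ))‖ ≤
      |t| ^ 3 * M * v := by
    have hx : ‖(-(t ^ 2 * v / 2 : ℝ) : ℂ)‖ = t ^ 2 * v / 2 := by
      rw [norm_neg, Complex.norm_real, Real.norm_of_nonneg (by positivity)]
    have hb := Complex.exp_bound (x := (-(t ^ 2 * v / 2 : ℝ) : ℂ)) (n := 2)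
      (by rw [hx]; linarith) (by norm_num)
    rw [hx] at hb
    simp only [Finset.sum_range_succ, Finset.sum_range_zero, Nat.factorial] at hb
    rw [norm_sub_rev]
    refine le_trans (le_of_eq ?_) (hb.trans ?_)
    · congr 1; push_cast; ring
    · have : t ^ 2 * v * (t ^ 2 * v) ≤ |t| * M * (t ^ 2 * v) :=
        mul_le_mul_of_nonneg_right htv (by positivity)
      have h3 : |t| ^ 3 * M * v = |t| * M * (t ^ 2 * v) := by rw [← sq_abs t]; ring
      rw [h3]
      push_cast
      nlinarith [mul_nonneg (sq_nonneg t) hv0]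
  calc _ ≤ _ := norm_sub_le_norm_sub_add_norm_sub _ (1 - (t ^ 2 * v / 2 : ℝ) : ℂ) _
    _ ≤ _ := add_le_add e1 e2
    _ = _ := by ring

end NormalizedTrace

/-! ### Pauli strings -/

section PauliStrings

variable {n : ℕ}

theorem normTrace_tensor (M : Fin n → Matrix (Fin 2) (Fin 2) ℂ) :
    normTrace (tensor M) = ∏ i, ((2 : ℂ)⁻¹ * (M i).trace) := by
  have h : (tensor M).trace = ∏ i, (M i).trace := by
    simp only [Matrix.trace, tensor, Matrix.diag_apply, Matrix.of_apply]
    rw [Finset.prod_univ_sum, Fintype.piFinset_univ]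
  rw [normTrace_apply, h, Finset.prod_mul_distrib]
  simp

theorem tensor_one : tensor (fun _ : Fin n => (1 : Matrix (Fin 2) (Fin 2) ℂ)) = 1 := by
  ext x y
  simp only [tensor, Matrix.of_apply, Matrix.one_apply]
  by_cases h : x = y
  · simp [h]
  · obtain ⟨i, hi⟩ := Function.ne_iff.1 h
    rw [if_neg h]
    exact Finset.prod_eq_zero (Finset.mem_univ i) (by simp [hi])

/-- The Pauli matrices, with the identity, are orthonormal for the normalized trace. -/
theorem half_trace_pauli_mul (a b : Fin 4) :
    (2 : ℂ)⁻¹ * (pauli a * pauli b).trace = if a = b then 1 else 0 := by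
  fin_cases a <;> fin_cases b <;>
    simp [pauli, Matrix.trace_fin_two] <;> norm_num

/-- The Pauli string `σ⁽ᶠ⁽¹⁾⁾ ⊗ ⋯ ⊗ σ⁽ᶠ⁽ⁿ⁾⁾`. -/
def pauliString (f : Fin n → Fin 4) : Matrix (Fin n → Fin 2) (Fin n → Fin 2) ℂ :=
  tensor fun i => pauli (f i)

theorem pauli_zero : pauli 0 = 1 := by
  ext i j; fin_cases i <;> fin_cases j <;> simp [pauli]

theorem pauli_mul_self (a : Fin 4) : pauli a * pauli a = 1 := by
  fin_cases a <;> ext i j <;> fin_cases i <;> fin_cases j <;> simp [pauli]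

theorem pauliString_isHermitian (f : Fin n → Fin 4) : (pauliString f).IsHermitian := by
  unfold Matrix.IsHermitian pauliString
  rw [tensor_conjTranspose]
  simp only [pauli_conjTranspose]

/-- Pauli strings are orthonormal for the inner product given by the normalized trace. -/
theorem normTrace_pauliString_mul (f g : Fin n → Fin 4) :
    normTrace (pauliString f * pauliString g) = if f = g then 1 else 0 := by
  rw [pauliString, pauliString, tensor_mul, normTrace_tensor]
  simp only [half_trace_pauli_mul]
  by_cases h : f = g
  · simp [h]
  · obtain ⟨i, hi⟩ := Function.ne_iff.1 h
    rw [if_neg h]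
    exact Finset.prod_eq_zero (Finset.mem_univ i) (by simp [hi])

theorem normTrace_pauliString_eq_zero {f : Fin n → Fin 4} (hf : f ≠ 0) :
    normTrace (pauliString f) = 0 := by
  have h1 : pauliString (0 : Fin n → Fin 4) = 1 := by
    simp [pauliString, pauli_zero, tensor_one]
  have h := normTrace_pauliString_mul f 0
  rwa [h1, mul_one, if_neg hf] at h

theorem norm_pauliString_le (f : Fin n → Fin 4) : ‖pauliString f‖ ≤ 1 := by
  have h1 : pauliString f * pauliString f = 1 := by
    simp [pauliString, tensor_mul, pauli_mul_self, tensor_one]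
  have h2 : star (pauliString f) = pauliString f := pauliString_isHermitian f
  have : pauliString f ∈ unitary (Matrix (Fin n → Fin 2) (Fin n → Fin 2) ℂ) := by
    rw [Unitary.mem_iff, h2]; exact ⟨h1, h1⟩
  exact (CStarRing.norm_of_mem_unitary this).le

end PauliStrings

/-! ### Locality and independence -/

section LocalAlgebra

variable {n : ℕ}

/-- The product operators that act as the identity outside the set `S` of sites. -/
def localTensors (S : Set (Fin n)) : Submonoid (Matrix (Fin n → Fin 2) (Fin n → Fin 2) ℂ) where
  carrier := {X | ∃ M, (∀ i, i ∉ S → M i = 1) ∧ tensor M = X}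
  one_mem' := ⟨fun _ => 1, fun _ _ => rfl, tensor_one⟩
  mul_mem' := by
    rintro _ _ ⟨M, hM, rfl⟩ ⟨N, hN, rfl⟩
    exact ⟨fun i => M i * N i, fun i hi => by simp [hM i hi, hN i hi], (tensor_mul M N).symm⟩

/-- The algebra of operators supported on the set `S` of sites. -/
def localAlgebra (S : Set (Fin n)) : Subalgebra ℂ (Matrix (Fin n → Fin 2) (Fin n → Fin 2) ℂ) :=
  Algebra.adjoin ℂ (localTensors S)

theorem mem_localAlgebra_iff {S : Set (Fin n)} {X : Matrix (Fin n → Fin 2) (Fin n → Fin 2) ℂ} :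
    X ∈ localAlgebra S ↔ X ∈ Submodule.span ℂ (localTensors S : Set _) := by
  rw [localAlgebra, ← Subalgebra.mem_toSubmodule, Algebra.adjoin_eq_span, Submonoid.closure_eq]

theorem localAlgebra_mono {S T : Set (Fin n)} (h : S ⊆ T) : localAlgebra S ≤ localAlgebra T :=
  Algebra.adjoin_mono fun _ ⟨M, hM, hX⟩ => ⟨M, fun i hi => hM i fun hS => hi (h hS), hX⟩

/-- Operators with disjoint supports are independent with respect to the normalized trace, and
they commute. -/
theorem normTrace_mul_and_commute_of_disjoint {S T : Set (Fin n)} (hST : Disjoint S T)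
    {X Y : Matrix (Fin n → Fin 2) (Fin n → Fin 2) ℂ} (hX : X ∈ localAlgebra S)
    (hY : Y ∈ localAlgebra T) :
    normTrace (X * Y) = normTrace X * normTrace Y ∧ Commute X Y := by
  rw [mem_localAlgebra_iff] at hX hY
  induction hX, hY using Submodule.span_induction₂ with
  | mem_mem X Y hX hY =>
    obtain ⟨M, hM, rfl⟩ := hX
    obtain ⟨N, hN, rfl⟩ := hY
    have hMN : ∀ i, M i = 1 ∨ N i = 1 := fun i => by
      by_cases hi : i ∈ S
      · exact Or.inr (hN i (Set.disjoint_left.1 hST hi))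
      · exact Or.inl (hM i hi)
    constructor
    · rw [tensor_mul, normTrace_tensor, normTrace_tensor, normTrace_tensor,
        ← Finset.prod_mul_distrib]
      refine Finset.prod_congr rfl fun i _ => ?_
      rcases hMN i with h | h <;> simp [h]
    · rw [Commute, SemiconjBy, tensor_mul, tensor_mul]
      congr 1
      funext i
      rcases hMN i with h | h <;> simp [h]
  | zero_left Y hY => simp
  | zero_right X hX => simp
  | add_left X₁ X₂ Y _ _ _ h₁ h₂ =>
    exact ⟨by rw [add_mul, map_add, map_add, h₁.1, h₂.1, add_mul], h₁.2.add_left h₂.2⟩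
  | add_right X Y₁ Y₂ _ _ _ h₁ h₂ =>
    exact ⟨by rw [mul_add, map_add, map_add, h₁.1, h₂.1, mul_add], h₁.2.add_right h₂.2⟩
  | smul_left r X Y _ _ h =>
    exact ⟨by rw [smul_mul_assoc, map_smul, map_smul, h.1, smul_mul_assoc], h.2.smul_left r⟩
  | smul_right r X Y _ _ h =>
    exact ⟨by rw [mul_smul_comm, map_smul, map_smul, h.1, mul_smul_comm], h.2.smul_right r⟩

theorem exp_mem_localAlgebra {S : Set (Fin n)} {X : Matrix (Fin n → Fin 2) (Fin n → Fin 2) ℂ}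
    (hX : X ∈ localAlgebra S) : NormedSpace.exp X ∈ localAlgebra S := by
  have hclosed : IsClosed (localAlgebra S : Set (Matrix (Fin n → Fin 2) (Fin n → Fin 2) ℂ)) :=
    Submodule.closed_of_finiteDimensional (Subalgebra.toSubmodule (localAlgebra S))
  have hs := NormedSpace.exp_series_hasSum_exp' (𝕂 := ℂ) X
  exact hclosed.mem_of_tendsto hs (Eventually.of_forall fun s =>
    sum_mem fun k _ => Subalgebra.smul_mem _ (pow_mem hX k) _)

theorem pauliString_mem_localAlgebra {S : Set (Fin n)} {f : Fin n → Fin 4}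
    (hf : ∀ i, i ∉ S → f i = 0) : pauliString f ∈ localAlgebra S :=
  Algebra.subset_adjoin ⟨_, fun i hi => by rw [hf i hi, pauli_zero], rfl⟩

/-- Characteristic functions of sums of operators with disjoint supports factorize. -/
theorem normTrace_exp_sum {q : Type*} [DecidableEq q] (Q : Finset q) (S : q → Set (Fin n))
    (hS : Pairwise fun i j => Disjoint (S i) (S j))
    (X : q → Matrix (Fin n → Fin 2) (Fin n → Fin 2) ℂ) (hX : ∀ i, X i ∈ localAlgebra (S i)) :
    normTrace (NormedSpace.exp (∑ i ∈ Q, X i)) = ∏ i ∈ Q, normTrace (NormedSpace.exp (X i)) := by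
  induction Q using Finset.induction_on with
  | empty => simp [normTrace_one]
  | insert a Q ha ih =>
    have hQ : ∑ i ∈ Q, X i ∈ localAlgebra (⋃ i ∈ Q, S i) :=
      sum_mem fun i hi => localAlgebra_mono (Set.subset_biUnion_of_mem (u := S) hi) (hX i)
    have hd : Disjoint (S a) (⋃ i ∈ Q, S i) := by
      simp only [Set.disjoint_iUnion_right]
      exact fun i hi => hS fun h => ha (h ▸ hi)
    rw [Finset.sum_insert ha, Finset.prod_insert ha, ← ih,
      Matrix.exp_add_of_commute _ _ (normTrace_mul_and_commute_of_disjoint hd (hX a) hQ).2,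
      (normTrace_mul_and_commute_of_disjoint hd (exp_mem_localAlgebra (hX a))
        (exp_mem_localAlgebra hQ)).1]

end LocalAlgebra

/-! ### The link terms of the Hamiltonian -/

section Links

variable {n : ℕ}

/-- The indices of the Pauli string `σ_j⁽ᵃ⁾ σ_{j+1}⁽ᵇ⁺¹⁾`, for `p = (j, a, b)`: `a` at site `j`,
`b + 1` at the next site and `0` elsewhere. -/
def linkString (p : Fin n × Fin 4 × Fin 3) : Fin n → Fin 4 :=
  Function.update (Function.update 0 p.1 p.2.1) (finRotate n p.1) p.2.2.succ

theorem linkString_ne_zero (p : Fin n × Fin 4 × Fin 3) : linkString p ≠ 0 := by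
  intro h
  have := congrFun h (finRotate n p.1)
  simp [linkString, -finRotate_apply] at this

theorem linkString_apply_of_ne (p : Fin n × Fin 4 × Fin 3) {i : Fin n} (h1 : i ≠ p.1)
    (h2 : i ≠ finRotate n p.1) : linkString p i = 0 := by
  rw [linkString, Function.update_of_ne h2, Function.update_of_ne h1, Pi.zero_apply]

theorem finRotate_finRotate_ne (hn : 3 ≤ n) (j : Fin n) : finRotate n (finRotate n j) ≠ j := by
  obtain ⟨m, rfl⟩ : ∃ m, n = m + 3 := ⟨n - 3, by omega⟩
  rw [finRotate_apply, finRotate_apply, add_assoc, Ne, add_eq_left, Fin.ext_iff]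
  simp [Fin.val_add, Nat.mod_eq_of_lt (show 2 < m + 3 by omega)]

/-- Different coefficients belong to different Pauli strings. For `n = 2` this fails: the links
`(1, 2)` and `(2, 1)` then join the same sites. -/
theorem linkString_injective (hn : 3 ≤ n) : Function.Injective (linkString (n := n)) := by
  -- The end of a link carries a nontrivial Pauli matrix, hence is a site of any link with the same
  -- string; two different links can then agree only if each one starts where the other ends.
  have key : ∀ p q : Fin n × Fin 4 × Fin 3, linkString p = linkString q → p.1 ≠ q.1 →
      finRotate n p.1 = q.1 := by
    intro p q h hpq
    by_contra hne
    have h1 : linkString p (finRotate n p.1) = p.2.2.succ := by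
      simp [linkString, -finRotate_apply]
    rw [h, linkString_apply_of_ne q hne fun h' => hpq ((finRotate n).injective h')] at h1
    exact (Fin.succ_ne_zero _) h1.symm
  intro p q h
  have h1 : p.1 = q.1 := by
    by_contra hpq
    have e1 := key p q h hpq
    have e2 := key q p h.symm (Ne.symm hpq)
    exact finRotate_finRotate_ne hn p.1 (by rw [e1, e2])
  obtain ⟨j, a, b⟩ := p
  obtain ⟨j', a', b'⟩ := q
  obtain rfl : j = j' := h1
  have hb := congrFun h (finRotate n j)
  have ha := congrFun h j
  have hne := finRotate_ne (by omega : 2 ≤ n) j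
  simp only [linkString, Function.update_self, Function.update_of_ne hne] at ha hb
  rw [ha, Fin.succ_injective _ hb]

theorem siteOp_mul_siteOp_finRotate (hn : 2 ≤ n) (j : Fin n) (a : Fin 4) (b : Fin 3) :
    siteOp j a * siteOp (finRotate n j) b.succ = pauliString (linkString (j, a, b)) := by
  rw [siteOp, siteOp, tensor_mul, pauliString]
  congr 1
  funext i
  have hne := finRotate_ne hn j
  by_cases h1 : i = finRotate n j
  · subst h1
    simp [linkString, Function.update_of_ne hne.symm, -finRotate_apply]
  · by_cases h2 : i = j
    · subst h2
      simp [linkString, Function.update_of_ne h1, -finRotate_apply]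
    · simp [linkString, Function.update_of_ne h1, Function.update_of_ne h2, pauli_zero,
        -finRotate_apply]

/-- The part of the Hamiltonian that consists of the links `(j, j + 1)` with `j ∈ K`. It keeps the
prefactor `n^{-1/2}` of the whole ring. -/
noncomputable def partialHamiltonian (α : Fin 4 → Fin 3 → Fin n → ℝ) (K : Finset (Fin n)) :
    Matrix (Fin n → Fin 2) (Fin n → Fin 2) ℂ :=
  ((1 / √(n : ℝ) : ℝ) : ℂ) • ∑ p ∈ K ×ˢ Finset.univ,
    ((α p.2.1 p.2.2 p.1 : ℝ) : ℂ) • pauliString (linkString p)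

variable (α : Fin 4 → Fin 3 → Fin n → ℝ)

theorem hamiltonian_eq_partialHamiltonian (hn : 2 ≤ n) :
    hamiltonian n α = partialHamiltonian α Finset.univ := by
  simp only [hamiltonian, partialHamiltonian, siteOp_mul_siteOp_finRotate hn,
    Finset.univ_product_univ, Fintype.sum_prod_type]

theorem partialHamiltonian_isHermitian (K : Finset (Fin n)) :
    (partialHamiltonian α K).IsHermitian := by
  simp [Matrix.IsHermitian, partialHamiltonian, Matrix.conjTranspose_smul,
    Matrix.conjTranspose_sum, (pauliString_isHermitian _).eq]

theorem partialHamiltonian_sub_filter (K : Finset (Fin n)) (P : Fin n → Prop) [DecidablePred P] :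
    partialHamiltonian α K - partialHamiltonian α (K.filter P) =
      partialHamiltonian α (K.filter fun j => ¬ P j) := by
  rw [partialHamiltonian, partialHamiltonian, partialHamiltonian, ← smul_sub]
  congr 1
  rw [sub_eq_iff_eq_add', Finset.sum_product, Finset.sum_product, Finset.sum_product,
    Finset.sum_filter_add_sum_filter_not]

theorem normTrace_partialHamiltonian (K : Finset (Fin n)) :
    normTrace (partialHamiltonian α K) = 0 := by
  simp [partialHamiltonian, normTrace_pauliString_eq_zero (linkString_ne_zero _)]

theorem normTrace_partialHamiltonian_sq (hn : 3 ≤ n) (K : Finset (Fin n)) :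
    normTrace (partialHamiltonian α K ^ 2) =
      ((1 / (n : ℝ) * ∑ j ∈ K, ∑ a, ∑ b, α a b j ^ 2 : ℝ) : ℂ) := by
  have hs : (((1 / √(n : ℝ) : ℝ) : ℂ)) * ((1 / √(n : ℝ) : ℝ) : ℂ) = ((1 / (n : ℝ) : ℝ) : ℂ) := by
    rw [← Complex.ofReal_mul, div_mul_div_comm, Real.mul_self_sqrt (Nat.cast_nonneg n), one_mul]
  rw [sq, partialHamiltonian, smul_mul_smul_comm, map_smul, hs, Complex.ofReal_mul, smul_eq_mul]
  congr 1
  simp only [Finset.sum_mul_sum, map_sum, smul_mul_smul_comm, map_smul,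
    normTrace_pauliString_mul, (linkString_injective hn).eq_iff, smul_eq_mul, mul_ite, mul_one,
    mul_zero, Finset.sum_ite_eq]
  rw [Finset.sum_congr rfl fun p hp => if_pos hp, Finset.sum_product]
  simp [Fintype.sum_prod_type, sq]

theorem norm_partialHamiltonian_le {C : ℝ} (hα : ∀ a b j, |α a b j| ≤ C) (K : Finset (Fin n)) :
    ‖partialHamiltonian α K‖ ≤ 12 * C * K.card / √n := by
  rw [partialHamiltonian, norm_smul, Complex.norm_real, Real.norm_of_nonneg (by positivity),
    one_div_mul_eq_div]
  gcongr
  refine (norm_sum_le_of_le _ (n := fun _ => C) fun p _ => ?_).trans (le_of_eq ?_)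
  · rw [norm_smul, Complex.norm_real]
    exact (mul_le_of_le_one_right (norm_nonneg _) (norm_pauliString_le _)).trans (hα _ _ _)
  · simp; ring

theorem partialHamiltonian_mem_localAlgebra {S : Set (Fin n)} {K : Finset (Fin n)}
    (h1 : ∀ j ∈ K, j ∈ S) (h2 : ∀ j ∈ K, finRotate n j ∈ S) :
    partialHamiltonian α K ∈ localAlgebra S := by
  refine Subalgebra.smul_mem _ (sum_mem fun p hp => Subalgebra.smul_mem _
    (pauliString_mem_localAlgebra fun i hi => ?_) _) _
  have hp' := (Finset.mem_product.1 hp).1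
  exact linkString_apply_of_ne p (fun h => hi (h ▸ h1 _ hp')) (fun h => hi (h ▸ h2 _ hp'))

end Links

/-! ### Decomposition of the ring into blocks -/

section Blocks

variable {n : ℕ} (α : Fin 4 → Fin 3 → Fin n → ℝ)

theorem norm_prod_sub_prod_le {q : Type*} (Q : Finset q) (z w : q → ℂ)
    (hz : ∀ i ∈ Q, ‖z i‖ ≤ 1) (hw : ∀ i ∈ Q, ‖w i‖ ≤ 1) :
    ‖∏ i ∈ Q, z i - ∏ i ∈ Q, w i‖ ≤ ∑ i ∈ Q, ‖z i - w i‖ := by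
  classical
  induction Q using Finset.induction_on with
  | empty => simp
  | insert a Q ha ih =>
    rw [Finset.prod_insert ha, Finset.prod_insert ha, Finset.sum_insert ha]
    have h1 : ‖∏ i ∈ Q, z i‖ ≤ 1 := by
      rw [norm_prod]
      exact Finset.prod_le_one (fun _ _ => norm_nonneg _)
        fun i hi => hz i (Finset.mem_insert_of_mem hi)
    have ih' := ih (fun i hi => hz i (Finset.mem_insert_of_mem hi))
      fun i hi => hw i (Finset.mem_insert_of_mem hi)
    calc _ = ‖(z a - w a) * ∏ i ∈ Q, z i + w a * (∏ i ∈ Q, z i - ∏ i ∈ Q, w i)‖ := by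
          congr 1; ring
      _ ≤ ‖z a - w a‖ * ‖∏ i ∈ Q, z i‖ + ‖w a‖ * ‖∏ i ∈ Q, z i - ∏ i ∈ Q, w i‖ := by
          rw [← norm_mul, ← norm_mul]; exact norm_add_le _ _
      _ ≤ ‖z a - w a‖ * 1 + 1 * ‖∏ i ∈ Q, z i - ∏ i ∈ Q, w i‖ := by
          gcongr
          exact hw a (Finset.mem_insert_self _ _)
      _ ≤ _ := by rw [mul_one, one_mul]; gcongr

theorem re_normTrace_partialHamiltonian_sq (hn : 3 ≤ n) (K : Finset (Fin n)) :
    (normTrace (partialHamiltonian α K ^ 2)).re = 1 / (n : ℝ) * ∑ j ∈ K, ∑ a, ∑ b, α a b j ^ 2 := by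
  rw [normTrace_partialHamiltonian_sq α hn, Complex.ofReal_re]

theorem re_normTrace_partialHamiltonian_sq_le (hn : 3 ≤ n) {C : ℝ} (hα : ∀ a b j, |α a b j| ≤ C)
    (K : Finset (Fin n)) :
    (normTrace (partialHamiltonian α K ^ 2)).re ≤ 12 * C ^ 2 * (K.card / n) := by
  rw [re_normTrace_partialHamiltonian_sq α hn]
  have : ∑ j ∈ K, ∑ a, ∑ b, α a b j ^ 2 ≤ ∑ _j ∈ K, ∑ _a : Fin 4, ∑ _b : Fin 3, C ^ 2 := by
    refine Finset.sum_le_sum fun j _ => Finset.sum_le_sum fun a _ => Finset.sum_le_sum fun b _ => ?_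
    exact sq_le_sq' (neg_le_of_abs_le (hα a b j)) (le_of_abs_le (hα a b j))
  calc _ ≤ 1 / (n : ℝ) * ∑ _j ∈ K, ∑ _a : Fin 4, ∑ _b : Fin 3, C ^ 2 := by gcongr
    _ = _ := by simp; ring

theorem abs_exp_neg_mul_one_sub_sub_exp_neg_le {x ε : ℝ} (hx : 0 ≤ x) (h0 : 0 ≤ ε) (h1 : ε ≤ 1) :
    |Real.exp (-(x * (1 - ε))) - Real.exp (-x)| ≤ x * ε := by
  have hfac : Real.exp (-x) = Real.exp (-(x * (1 - ε))) * Real.exp (-(x * ε)) := by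
    rw [← Real.exp_add]; ring_nf
  have hx1 : 0 ≤ x * (1 - ε) := mul_nonneg hx (by linarith)
  have hx2 : 0 ≤ x * ε := mul_nonneg hx h0
  have h2 : Real.exp (-(x * (1 - ε))) ≤ 1 := Real.exp_le_one_iff.2 (by linarith)
  have h3 : Real.exp (-(x * ε)) ≤ 1 := Real.exp_le_one_iff.2 (by linarith)
  have h4 : 1 - Real.exp (-(x * ε)) ≤ x * ε := by
    have := Real.add_one_le_exp (-(x * ε)); linarith
  rw [hfac, ← mul_one_sub, abs_of_nonneg (mul_nonneg (Real.exp_nonneg _) (sub_nonneg.2 h3))]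
  exact (mul_le_mul h2 h4 (sub_nonneg.2 h3) zero_le_one).trans (one_mul _).le

/-- Lindeberg's argument for a Hamiltonian without links between sites of different colours: the
colour classes are independent blocks, each of operator norm at most `12 C L / √n`. -/
theorem norm_normTrace_exp_sub_gaussian_le_of_monochromatic (hn : 3 ≤ n) {C : ℝ}
    (hα : ∀ a b j, |α a b j| ≤ C) (c : Fin n → ℕ) {L : ℕ}
    (hL : ∀ k, (Finset.univ.filter fun j => c j = k).card ≤ L)
    {K : Finset (Fin n)} (hK : ∀ j ∈ K, c (finRotate n j) = c j)
    (hK1 : (normTrace (partialHamiltonian α K ^ 2)).re ≤ 1)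
    {t : ℝ} (ht : |t| * (12 * C * L / √n) ≤ 1) :
    ‖normTrace (NormedSpace.exp (((t : ℂ) * Complex.I) • partialHamiltonian α K)) -
      Complex.exp (-(t ^ 2 * (normTrace (partialHamiltonian α K ^ 2)).re / 2 : ℝ))‖ ≤
      2 * |t| ^ 3 * (12 * C * L / √n) := by
  have hC : 0 ≤ C := (abs_nonneg _).trans (hα 0 0 ⟨0, by omega⟩)
  obtain ⟨M, hM⟩ : ∃ M, M = 12 * C * L / √n := ⟨_, rfl⟩
  have hM0 : 0 ≤ M := by rw [hM]; positivity
  rw [← hM] at ht ⊢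
  set Q : Finset ℕ := Finset.univ.image c with hQ
  have hmaps : ∀ j ∈ K, c j ∈ Q := fun j _ => Finset.mem_image_of_mem c (Finset.mem_univ j)
  set B : ℕ → Finset (Fin n) := fun k => K.filter fun j => c j = k with hB
  have hsum : partialHamiltonian α K = ∑ k ∈ Q, partialHamiltonian α (B k) := by
    simp only [partialHamiltonian, ← Finset.smul_sum]
    congr 1
    simp only [Finset.sum_product]
    exact (Finset.sum_fiberwise_of_maps_to hmaps _).symm
  obtain ⟨v, hv⟩ : ∃ v : ℕ → ℝ, ∀ k, v k = (normTrace (partialHamiltonian α (B k) ^ 2)).re :=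
    ⟨_, fun _ => rfl⟩
  have hvsum : (normTrace (partialHamiltonian α K ^ 2)).re = ∑ k ∈ Q, v k := by
    simp only [hv, re_normTrace_partialHamiltonian_sq α hn, ← Finset.mul_sum]
    rw [Finset.sum_fiberwise_of_maps_to hmaps]
  have hv0 : ∀ k, 0 ≤ v k := fun k => by
    rw [hv, re_normTrace_partialHamiltonian_sq α hn]; positivity
  have hfactor : normTrace (NormedSpace.exp (((t : ℂ) * Complex.I) • partialHamiltonian α K)) =
      ∏ k ∈ Q, normTrace (NormedSpace.exp
        (((t : ℂ) * Complex.I) • partialHamiltonian α (B k))) := by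
    rw [hsum, Finset.smul_sum]
    refine normTrace_exp_sum Q (fun k => {j | c j = k}) ?_ _ fun k => ?_
    · intro k l hkl
      exact Set.disjoint_left.2 fun j hj hj' => hkl (hj.symm.trans hj')
    · refine Subalgebra.smul_mem _ (partialHamiltonian_mem_localAlgebra α ?_ ?_) _
      · exact fun j hj => (Finset.mem_filter.1 hj).2
      · exact fun j hj => (hK j (Finset.mem_filter.1 hj).1).trans (Finset.mem_filter.1 hj).2
  have hblock : ∀ k, ‖normTrace (NormedSpace.exp
      (((t : ℂ) * Complex.I) • partialHamiltonian α (B k))) -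
      Complex.exp (-(t ^ 2 * v k / 2 : ℝ))‖ ≤ 2 * |t| ^ 3 * M * v k := by
    intro k
    rw [hv]
    refine norm_normTrace_exp_sub_gaussian_le (partialHamiltonian_isHermitian α _)
      (normTrace_partialHamiltonian α _) ?_ ht
    refine (norm_partialHamiltonian_le α hα _).trans ?_
    rw [hM]
    gcongr
    exact (Finset.card_le_card (Finset.filter_subset_filter _ (Finset.subset_univ K))).trans
      (hL k)
  have hgauss : ∀ k, ‖Complex.exp (-(t ^ 2 * v k / 2 : ℝ))‖ ≤ 1 := fun k => by
    rw [← Complex.ofReal_neg, ← Complex.ofReal_exp, Complex.norm_real,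
      Real.norm_of_nonneg (Real.exp_nonneg _)]
    have := mul_nonneg (sq_nonneg t) (hv0 k)
    exact Real.exp_le_one_iff.2 (by linarith)
  have hprod : Complex.exp (-(t ^ 2 * (normTrace (partialHamiltonian α K ^ 2)).re / 2 : ℝ)) =
      ∏ k ∈ Q, Complex.exp (-(t ^ 2 * v k / 2 : ℝ)) := by
    rw [← Complex.exp_sum, hvsum, Finset.mul_sum, Finset.sum_div, Finset.sum_neg_distrib,
      Complex.ofReal_sum]
  rw [hfactor, hprod]
  refine (norm_prod_sub_prod_le _ _ _
    (fun k _ => norm_normTrace_exp_le_one (partialHamiltonian_isHermitian α _) t)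
    (fun k _ => hgauss k)).trans ((Finset.sum_le_sum fun k _ => hblock k).trans ?_)
  rw [← Finset.mul_sum, ← hvsum]
  exact mul_le_of_le_one_right (by positivity) hK1

/-- Quantitative form of the limit theorem, for an arbitrary colouring of the sites: `L` bounds the
size of the colour classes, and `r` bounds the variance carried by the links that join different
colours, estimated through their number. -/
theorem norm_normTrace_exp_hamiltonian_sub_gaussian_le (hn : 3 ≤ n) {C : ℝ}
    (hα : ∀ a b j, |α a b j| ≤ C)
    (hnorm : (1 / (n : ℝ)) * ∑ j : Fin n, ∑ a : Fin 4, ∑ b : Fin 3, (α a b j) ^ 2 = 1)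
    (c : Fin n → ℕ) {L : ℕ} (hL : ∀ k, (Finset.univ.filter fun j => c j = k).card ≤ L)
    {t : ℝ} (ht : |t| * (12 * C * L / √n) ≤ 1) {r : ℝ}
    (hr : 12 * C ^ 2 *
      ((Finset.univ.filter fun j => ¬ c (finRotate n j) = c j).card / n) ≤ r) :
    ‖normTrace (NormedSpace.exp (((t : ℂ) * Complex.I) • hamiltonian n α)) -
      Complex.exp (-(t ^ 2 / 2 : ℝ))‖ ≤
      |t| * √r + t ^ 2 / 2 * r + 2 * |t| ^ 3 * (12 * C * L / √n) := by
  set K : Finset (Fin n) := Finset.univ.filter fun j => c (finRotate n j) = c j with hK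
  set Kc : Finset (Fin n) := Finset.univ.filter fun j => ¬ c (finRotate n j) = c j with hKc
  have hsub : hamiltonian n α - partialHamiltonian α K = partialHamiltonian α Kc := by
    rw [hamiltonian_eq_partialHamiltonian α (by omega)]
    exact partialHamiltonian_sub_filter α _ fun j => c (finRotate n j) = c j
  obtain ⟨ε, hε⟩ : ∃ ε, ε = (normTrace (partialHamiltonian α Kc ^ 2)).re := ⟨_, rfl⟩
  have hεr : ε ≤ r := hε ▸ (re_normTrace_partialHamiltonian_sq_le α hn hα Kc).trans hr
  have hε0 : 0 ≤ ε := by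
    rw [hε, re_normTrace_partialHamiltonian_sq α hn]; positivity
  have hv : (normTrace (partialHamiltonian α K ^ 2)).re = 1 - ε := by
    rw [eq_sub_iff_add_eq, hε, re_normTrace_partialHamiltonian_sq α hn,
      re_normTrace_partialHamiltonian_sq α hn, ← mul_add,
      Finset.sum_filter_add_sum_filter_not]
    exact hnorm
  have hε1 : ε ≤ 1 := by
    have : 0 ≤ (normTrace (partialHamiltonian α K ^ 2)).re := by
      rw [re_normTrace_partialHamiltonian_sq α hn]; positivity
    linarith
  have e1 := norm_normTrace_exp_sub_le (hamiltonian_isHermitian (by omega : 2 ≤ n) α)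
    (partialHamiltonian_isHermitian α K) t
  rw [hsub, ← hε] at e1
  have e2 := norm_normTrace_exp_sub_gaussian_le_of_monochromatic α hn hα c hL
    (fun j hj => (Finset.mem_filter.1 hj).2 : ∀ j ∈ K, _) (by linarith) ht
  rw [hv] at e2
  have e3 : ‖Complex.exp (-(t ^ 2 * (1 - ε) / 2 : ℝ)) - Complex.exp (-(t ^ 2 / 2 : ℝ))‖ ≤
      t ^ 2 / 2 * ε := by
    rw [← Complex.ofReal_neg, ← Complex.ofReal_neg, ← Complex.ofReal_exp, ← Complex.ofReal_exp,
      ← Complex.ofReal_sub, Complex.norm_real, Real.norm_eq_abs, mul_div_right_comm]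
    exact abs_exp_neg_mul_one_sub_sub_exp_neg_le (by positivity) hε0 hε1
  calc _ ≤ _ := norm_sub_le_norm_sub_add_norm_sub _
        (normTrace (NormedSpace.exp (((t : ℂ) * Complex.I) • partialHamiltonian α K))) _
    _ ≤ |t| * √ε + (2 * |t| ^ 3 * (12 * C * L / √n) + t ^ 2 / 2 * ε) :=
        add_le_add e1 ((norm_sub_le_norm_sub_add_norm_sub _ _ _).trans (add_le_add e2 e3))
    _ ≤ |t| * √r + (2 * |t| ^ 3 * (12 * C * L / √n) + t ^ 2 / 2 * r) := by gcongr
    _ = _ := by ring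

theorem card_filter_div_eq_le (L : ℕ) (hL : 0 < L) (k : ℕ) :
    (Finset.univ.filter fun j : Fin n => (j : ℕ) / L = k).card ≤ L := by
  calc _ = ((Finset.univ.filter fun j : Fin n => (j : ℕ) / L = k).image
        fun j : Fin n => (j : ℕ)).card :=
        (Finset.card_image_of_injective _ Fin.val_injective).symm
    _ ≤ (Finset.Ico (k * L) (k * L + L)).card := by
        refine Finset.card_le_card fun i hi => ?_
        obtain ⟨j, hj, rfl⟩ := Finset.mem_image.1 hi
        have h := (Finset.mem_filter.1 hj).2
        subst h
        have h1 := Nat.div_add_mod (j : ℕ) L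
        have h2 := Nat.mod_lt (j : ℕ) hL
        rw [mul_comm] at h1
        rw [Finset.mem_Ico]
        omega
    _ = L := by simp

/-- When the ring is cut into intervals of length `L`, links are broken only at the multiples of `L`
and at the closing link from the last site to the first one. -/
theorem card_filter_div_finRotate_ne_le (L : ℕ) :
    (Finset.univ.filter fun j : Fin n =>
      ((finRotate n j : Fin n) : ℕ) / L ≠ (j : ℕ) / L).card ≤ n / L + 1 := by
  calc _ = ((Finset.univ.filter fun j : Fin n =>
        ((finRotate n j : Fin n) : ℕ) / L ≠ (j : ℕ) / L).image fun j : Fin n => (j : ℕ)).card :=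
        (Finset.card_image_of_injective _ Fin.val_injective).symm
    _ ≤ (insert (n - 1) ((Finset.range n).filter fun e => L ∣ e + 1)).card := by
        refine Finset.card_le_card fun i hi => ?_
        obtain ⟨j, hj, rfl⟩ := Finset.mem_image.1 hi
        have h := (Finset.mem_filter.1 hj).2
        rw [Finset.mem_insert]
        by_contra! hcon
        refine hcon.2 (Finset.mem_filter.2 ⟨Finset.mem_range.2 j.2, ?_⟩)
        by_contra hdvd
        apply h
        have hj2 := j.2
        have hval : ((finRotate n j : Fin n) : ℕ) = j + 1 := by
          obtain ⟨m, rfl⟩ : ∃ m, n = m + 1 := ⟨n - 1, by omega⟩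
          exact coe_finRotate_of_ne_last fun hl => hcon.1 (by simp [hl])
        rw [hval, Nat.succ_div_of_not_dvd hdvd]
    _ ≤ _ := by
        refine (Finset.card_insert_le _ _).trans ?_
        rw [Nat.card_multiples]

end Blocks

/-! ### The limit of large rings -/

section Limit

/-- The characteristic function of the density of states of `A` is the normalized trace of
`exp (i t A)`. -/
theorem charFun_eigenvalueMeasure {n : ℕ} {A : Matrix (Fin n → Fin 2) (Fin n → Fin 2) ℂ}
    (hA : A.IsHermitian) (t : ℝ) :
    charFun (eigenvalueMeasure hA) t =
      normTrace (NormedSpace.exp (((t : ℂ) * Complex.I) • A)) := by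
  rw [charFun_apply_real, eigenvalueMeasure, integral_smul_measure,
    integral_finsetSum_measure fun k _ => integrable_dirac (by simp), normTrace_exp_eq hA]
  simp only [integral_dirac, ENNReal.toReal_inv, ENNReal.toReal_pow, Complex.real_smul]
  congr 1
  · simp
  · refine Finset.sum_congr rfl fun k _ => ?_
    ring_nf

theorem tendsto_ceil_sqrt_sqrt_div_sqrt :
    Tendsto (fun n : ℕ => (⌈√√(n : ℝ)⌉₊ : ℝ) / √n) atTop (𝓝 0) := by
  have hs : Tendsto (fun n : ℕ => √√(n : ℝ)) atTop atTop :=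
    Real.tendsto_sqrt_atTop.comp (Real.tendsto_sqrt_atTop.comp tendsto_natCast_atTop_atTop)
  have h1 := tendsto_inv_atTop_zero.comp hs
  have h2 : Tendsto (fun n : ℕ => (√√(n : ℝ))⁻¹ + (√√(n : ℝ))⁻¹ ^ 2) atTop (𝓝 0) := by
    simpa using h1.add (h1.pow 2)
  refine tendsto_of_tendsto_of_tendsto_of_le_of_le' tendsto_const_nhds h2
    (Eventually.of_forall fun n => by positivity) ?_
  filter_upwards [eventually_gt_atTop 0] with n hn
  have hq : 0 < √√(n : ℝ) := by positivity
  have hq2 : √(n : ℝ) = √√(n : ℝ) ^ 2 := (Real.sq_sqrt (Real.sqrt_nonneg _)).symm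
  set q := √√(n : ℝ)
  have hceil := (Nat.ceil_lt_add_one hq.le).le
  rw [hq2]
  calc (⌈q⌉₊ : ℝ) / q ^ 2 ≤ (q + 1) / q ^ 2 := by gcongr
    _ = q⁻¹ + q⁻¹ ^ 2 := by field_simp

theorem tendsto_normTrace_exp_hamiltonian (α : (n : ℕ) → Fin 4 → Fin 3 → Fin n → ℝ) (C : ℝ)
    (hnorm : ∀ n : ℕ, 2 ≤ n →
      (1 / (n : ℝ)) * ∑ j : Fin n, ∑ a : Fin 4, ∑ b : Fin 3, (α n a b j) ^ 2 = 1)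
    (hbound : ∀ n : ℕ, 2 ≤ n → ∀ (a : Fin 4) (b : Fin 3) (j : Fin n), |α n a b j| < C) (t : ℝ) :
    Tendsto (fun n : ℕ => normTrace (NormedSpace.exp
      (((t : ℂ) * Complex.I) • hamiltonian n (α n)))) atTop
      (𝓝 (Complex.exp (-(t ^ 2 / 2 : ℝ)))) := by
  -- Blocks of length about `n ^ (1 / 4)`: long enough for the broken links to be negligible, short
  -- enough for the norm of a block, of order `L / √n`, to vanish.
  set L : ℕ → ℕ := fun n => ⌈√√(n : ℝ)⌉₊ with hL
  have hLtop : Tendsto (fun n => (L n : ℝ)) atTop atTop :=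
    tendsto_natCast_atTop_atTop.comp (tendsto_nat_ceil_atTop.comp
      (Real.tendsto_sqrt_atTop.comp (Real.tendsto_sqrt_atTop.comp tendsto_natCast_atTop_atTop)))
  have hM : Tendsto (fun n => 12 * C * L n / √(n : ℝ)) atTop (𝓝 0) := by
    simpa [mul_div_assoc] using tendsto_ceil_sqrt_sqrt_div_sqrt.const_mul (12 * C)
  have hr : Tendsto (fun n : ℕ => 12 * C ^ 2 * ((L n : ℝ)⁻¹ + (n : ℝ)⁻¹)) atTop (𝓝 0) := by
    simpa using ((tendsto_inv_atTop_zero.comp hLtop).add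
      (tendsto_inv_atTop_zero.comp tendsto_natCast_atTop_atTop)).const_mul (12 * C ^ 2)
  have hE := ((hr.sqrt.const_mul |t|).add (hr.const_mul (t ^ 2 / 2))).add
    (hM.const_mul (2 * |t| ^ 3))
  simp only [Real.sqrt_zero, mul_zero, add_zero] at hE
  rw [tendsto_iff_norm_sub_tendsto_zero]
  refine tendsto_of_tendsto_of_tendsto_of_le_of_le' tendsto_const_nhds hE
    (Eventually.of_forall fun n => norm_nonneg _) ?_
  have ht : ∀ᶠ n : ℕ in atTop, |t| * (12 * C * L n / √(n : ℝ)) ≤ 1 := by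
    have := hM.const_mul |t|
    rw [mul_zero] at this
    exact this.eventually_le_const one_pos
  filter_upwards [ht, eventually_ge_atTop 3] with n ht hn
  have hn0 : (0 : ℝ) < n := by exact_mod_cast (by omega : 0 < n)
  have hL0 : 0 < L n := Nat.ceil_pos.2 (by positivity)
  refine norm_normTrace_exp_hamiltonian_sub_gaussian_le (α n) hn
    (fun a b j => (hbound n (by omega) a b j).le) (hnorm n (by omega)) (fun j => (j : ℕ) / L n)
    (card_filter_div_eq_le (L n) hL0) ht ?_
  refine mul_le_mul_of_nonneg_left ?_ (by positivity)
  rw [div_le_iff₀ hn0, add_mul, inv_mul_cancel₀ hn0.ne', inv_mul_eq_div]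
  have hcard : ((Finset.univ.filter fun j : Fin n =>
      ¬ ((finRotate n j : Fin n) : ℕ) / L n = (j : ℕ) / L n).card : ℝ) ≤ (n / L n : ℕ) + 1 := by
    exact_mod_cast card_filter_div_finRotate_ne_le (n := n) (L n)
  exact hcard.trans (by gcongr; exact Nat.cast_div_le)

theorem tendsto_densityOfStates (α : (n : ℕ) → Fin 4 → Fin 3 → Fin n → ℝ) (C : ℝ)
    (hnorm : ∀ n : ℕ, 2 ≤ n →
      (1 / (n : ℝ)) * ∑ j : Fin n, ∑ a : Fin 4, ∑ b : Fin 3, (α n a b j) ^ 2 = 1)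
    (hbound : ∀ n : ℕ, 2 ≤ n → ∀ (a : Fin 4) (b : Fin 3) (j : Fin n), |α n a b j| < C) :
    Tendsto (fun n : ℕ => densityOfStates (n + 2) (Nat.le_add_left 2 n) (α (n + 2)))
      atTop (𝓝 stdNormal) := by
  refine ProbabilityMeasure.tendsto_of_tendsto_charFun fun t => ?_
  have h := (tendsto_normTrace_exp_hamiltonian α C hnorm hbound t).comp (tendsto_add_atTop_nat 2)
  convert! h using 2
  · exact charFun_eigenvalueMeasure _ t
  · change charFun (gaussianReal 0 1) t = _
    rw [charFun_gaussianReal]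
    push_cast
    ring_nf

theorem stdNormal_real_Iic (x : ℝ) : (stdNormal : Measure ℝ).real (Set.Iic x) =
    (1 / √(2 * Real.pi)) * ∫ t in Set.Iic x, Real.exp (-(t ^ 2) / 2) := by
  change (gaussianReal 0 1).real (Set.Iic x) = _
  rw [measureReal_def, gaussianReal_apply_eq_integral 0 one_ne_zero,
    ENNReal.toReal_ofReal (integral_nonneg fun y => gaussianPDFReal_nonneg 0 1 y),
    ← integral_const_mul]
  simp [gaussianPDFReal]

end Limit

end SpinChain

/-- The coefficients are `α n a b j` for the ring of `n` qubits. The conclusion consists of the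
identity between the two forms of the normalisation, the weak convergence of the density of states
along the ring sizes `n + 2 = 2, 3, …`, and the convergence of the distribution functions. -/
theorem theorem2 (α : (n : ℕ) → Fin 4 → Fin 3 → Fin n → ℝ) (C : ℝ)
    (hnorm : ∀ n : ℕ, 2 ≤ n →
      (1 / (n : ℝ)) * ∑ j : Fin n, ∑ a : Fin 4, ∑ b : Fin 3, (α n a b j) ^ 2 = 1)
    (hbound : ∀ n : ℕ, 2 ≤ n → ∀ (a : Fin 4) (b : Fin 3) (j : Fin n), |α n a b j| < C) :
    (∀ n : ℕ, 3 ≤ n →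
      (1 / (2 : ℂ) ^ n) * (SpinChain.hamiltonian n (α n) ^ 2).trace =
        (((1 / (n : ℝ)) * ∑ j : Fin n, ∑ a : Fin 4, ∑ b : Fin 3, (α n a b j) ^ 2 : ℝ) : ℂ)) ∧
    Tendsto (fun n : ℕ =>
        SpinChain.densityOfStates (n + 2) (Nat.le_add_left 2 n) (α (n + 2)))
      atTop (𝓝 SpinChain.stdNormal) ∧
    ∀ x : ℝ, Tendsto (fun n : ℕ =>
        (SpinChain.densityOfStates (n + 2) (Nat.le_add_left 2 n) (α (n + 2)) : Measure ℝ).real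
          (Set.Iic x))
      atTop (𝓝 ((1 / √(2 * Real.pi)) * ∫ t in Set.Iic x, Real.exp (-(t ^ 2) / 2))) := by
  have hlim := SpinChain.tendsto_densityOfStates α C hnorm hbound
  refine ⟨fun n hn => ?_, hlim, fun x => ?_⟩
  · rw [← SpinChain.normTrace_partialHamiltonian_sq (α n) hn Finset.univ,
      ← SpinChain.hamiltonian_eq_partialHamiltonian (α n) (by omega), SpinChain.normTrace_apply]
    simp
  · rw [← SpinChain.stdNormal_real_Iic x]
    have hfront : (SpinChain.stdNormal : Measure ℝ) (frontier (Set.Iic x)) = 0 := by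
      have : NullSingletonClass (gaussianReal 0 1) := nullSingletonClass_gaussianReal one_ne_zero
      rw [frontier_Iic]
      change gaussianReal 0 1 {x} = 0
      exact measure_singleton x
    exact (ENNReal.tendsto_toReal (measure_ne_top _ _)).comp
      (ProbabilityMeasure.tendsto_measure_of_null_frontier_of_tendsto' hlim hfront)
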